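/- Let $k\ge 1$ and $m\ge 1$ be integers. Let $V$ be the real vector space with basis the simple roots $\alpha_1,\dots,\alpha_k$ of type $A_k$ and symmetric bilinear form $\langle\alpha_i,\alpha_i\rangle=2$, $\langle\alpha_i,\alpha_j\rangle=-1$ if $|i-j|=1$, and $0$ otherwise. Put $\phi=\alpha_1+\dots+\alpha_k$ and $H_{v,p}=\{x\in V:\langle v,x\rangle=p\}$. Let $W$ be the group generated by the reflections $s_i$ in $H_{\alpha_i,0}$ for $1\le i\le k$ and the reflection $s_0$ in $H_{\phi,1}$; let $C=\{x:\langle\alpha_i,x\rangle\ge 0\text{ for all }i\}$ be the closed dominant chamber, $A_\emptyset=\{x\in C:\langle\phi,x\rangle\le 1\}$ the fundamental alcove, and $A_w=w^{-1}A_\emptyset$ for $w\in W$. The group $W$ acts on $(k+1)$-cores (partitions without a removable rim hook of length $k+1$): if a core $\mu$ has an addable cell of residue $i$ (the residue of a cell being its column index minus its row index modulo $k+1$), then $s_i\mu$ is $\mu$ with all addable cells of residue $i$ added; otherwise $s_i\mu$ is $\mu$ with all removable cells of residue $i$ (possibly none) removed. For a $(k+1)$-core $\mu$ let $\mathfrak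 p(\mu)$ be the partition whose $a$-th part is the number of cells in row $a$ of $\mu$ with hook length less than $k+1$. A partition is $k$-bounded if all its parts are at most $k$; a $k$-bounded partition $\lambda$ corresponds to the alcove $A_w\subseteq C$ if $\lambda=\mathfrak p(w\emptyset)$. For $1\le i\le k$ let $R_i=(i^{\,k+1-i})$ be the rectangular partition with $k+1-i$ parts equal to $i$. For partitions $\lambda,\mu$ let $\lambda\cup\mu$ be the partition obtained by arranging the parts of both in non-increasing order, and let $\lambda\subseteq\mu$ denote containment of Young diagrams. **Corollary.** Let $\lambda$ be a $k$-bounded partition that corresponds to an alcove $A_w\subseteq C$ lying below $H_{\phi,m}$, that is, $\langle\phi,x\rangle\le m$ for all $x\in A_w$. Then there are $i_1,\dots,i_{m-1}\in\{1,\dots,k\}$ such that $\lambda\subseteq R_{i_1}\cup\dots\cup R_{i_{m-1}}$ (for $m=1$ the union is the empty partition). -/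

import Mathlib

noncomputable section

/-! ### The affine reflection group of type `A_k` -/

namespace AffineA

/-- The space `V`: a vector `x` stands for `∑ i, x i • α_i`, where `α_0, …, α_{k-1}` are the
simple roots of type `A_k` (numbered from `0` instead of from `1`). -/
abbrev V (k : ℕ) : Type := Fin k → ℝ

/-- The symmetric bilinear form with `⟨α_i, α_i⟩ = 2`, `⟨α_i, α_{i±1}⟩ = -1` and `0` otherwise. -/
def form (k : ℕ) : LinearMap.BilinForm ℝ (V k) :=
  Matrix.toBilin' (Matrix.of fun i j : Fin k =>
    if i = j then (2 : ℝ) else if (i : ℕ) + 1 = j ∨ (j : ℕ) + 1 = i then -1 else 0)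

/-- The simple root `α_i`. -/
def simpleRoot (k : ℕ) (i : Fin k) : V k := Pi.single i 1

/-- The highest root `φ = α_1 + ⋯ + α_k`. -/
def highestRoot (k : ℕ) : V k := ∑ i, simpleRoot k i

/-- The orthogonal reflection `x ↦ x - (2 (⟨v, x⟩ - p) / ⟨v, v⟩) v` in the hyperplane
`H_{v,p} = {x | ⟨v, x⟩ = p}`. -/
def hyperplaneReflection (k : ℕ) (v : V k) (p : ℝ) : Equiv.Perm (V k) :=
  Function.Involutive.toPerm
    (fun x => x - (2 * (form k v x - p) / form k v v) • v) (by
      intro x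
      by_cases h : form k v v = 0
      · simp [h]
      · simp only [map_sub, map_smul, smul_eq_mul]
        rw [sub_sub, ← add_smul, sub_eq_self]
        have : 2 * (form k v x - p) / form k v v +
            2 * (form k v x - 2 * (form k v x - p) / form k v v * form k v v - p) /
              form k v v = 0 := by
          field_simp
          ring
        rw [this, zero_smul])

/-- The generators: `s_0` is the reflection in `H_{φ,1}`, and `s_i`, for `1 ≤ i ≤ k`, the
reflection in `H_{α_i,0}`. -/
def gen (k : ℕ) : Fin (k + 1) → Equiv.Perm (V k) :=
  Fin.cases (hyperplaneReflection k (highestRoot k) 1)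
    (fun i => hyperplaneReflection k (simpleRoot k i) 0)

/-- The affine reflection group `W`, acting faithfully on `V`. -/
def W (k : ℕ) : Subgroup (Equiv.Perm (V k)) := Subgroup.closure (Set.range (gen k))

/-- The closed dominant chamber. -/
def dominantChamber (k : ℕ) : Set (V k) := {x | ∀ i, 0 ≤ form k (simpleRoot k i) x}

/-- The (closed) fundamental alcove. -/
def fundamentalAlcove (k : ℕ) : Set (V k) :=
  {x | x ∈ dominantChamber k ∧ form k (highestRoot k) x ≤ 1}

/-- The alcove `A_w = w⁻¹ A_∅`. -/
def alcove (k : ℕ) (w : W k) : Set (V k) :=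
  (fun x => (w⁻¹ : Equiv.Perm (V k)) x) '' fundamentalAlcove k

/-- The points on or below the hyperplane `H_{φ,m}`. -/
def below (k m : ℕ) : Set (V k) := {x | form k (highestRoot k) x ≤ m}

end AffineA

/-! ### Partitions

Partitions are Young diagrams; the cell `(a, b)` lies in row `a` and column `b`, counted from
`0`. -/

namespace KBounded

/-- The addable cells of `μ`: the cells outside `μ` whose addition gives a Young diagram. The box
in which they are searched is no restriction, see `mem_addable`. -/
def addable (μ : YoungDiagram) : Finset (ℕ × ℕ) :=
  open Classical in
  (Finset.range (μ.colLen 0 + 1) ×ˢ Finset.range (μ.rowLen 0 + 1)).filter fun c =>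
    c ∉ μ ∧ IsLowerSet (insert c (μ.cells : Set (ℕ × ℕ)))

theorem mem_addable (μ : YoungDiagram) (c : ℕ × ℕ) :
    c ∈ addable μ ↔ c ∉ μ ∧ IsLowerSet (insert c (μ.cells : Set (ℕ × ℕ))) := by
  classical
  simp only [addable, Finset.mem_filter, Finset.mem_product, Finset.mem_range,
    and_iff_right_iff_imp]
  rintro ⟨-, h⟩
  obtain ⟨a, b⟩ := c
  constructor
  · by_contra hlt
    have hlt : μ.colLen 0 + 1 ≤ a := by simpa using hlt
    have h1 := h (show ((a - 1, 0) : ℕ × ℕ) ≤ (a, b) from ⟨by simp, by simp⟩)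
      (Set.mem_insert _ _)
    rcases h1 with h1 | h1
    · have := congrArg Prod.fst h1
      simp at this
      omega
    · have h2 : (a - 1, 0) ∈ μ := h1
      rw [YoungDiagram.mem_iff_lt_colLen] at h2
      omega
  · by_contra hlt
    have hlt : μ.rowLen 0 + 1 ≤ b := by simpa using hlt
    have h1 := h (show ((0, b - 1) : ℕ × ℕ) ≤ (a, b) from ⟨by simp, by simp⟩)
      (Set.mem_insert _ _)
    rcases h1 with h1 | h1
    · have := congrArg Prod.snd h1
      simp at this
      omega
    · have h2 : (0, b - 1) ∈ μ := h1
      rw [YoungDiagram.mem_iff_lt_rowLen] at h2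
      omega

/-- The removable cells of `μ`: the cells of `μ` whose removal gives a Young diagram. -/
def removable (μ : YoungDiagram) : Finset (ℕ × ℕ) :=
  open Classical in
  μ.cells.filter fun c => IsLowerSet ((μ.cells : Set (ℕ × ℕ)) \ {c})

/-- The cell `c` has content (column minus row) congruent to `r` modulo `k + 1`. -/
def HasResidue (k : ℕ) (r : Fin (k + 1)) (c : ℕ × ℕ) : Prop :=
  (c.2 : ℤ) - (c.1 : ℤ) ≡ (r : ℤ) [ZMOD (k + 1 : ℤ)]

/-- The addable cells of residue `r`. -/
def addableRes (k : ℕ) (r : Fin (k + 1)) (μ : YoungDiagram) : Finset (ℕ × ℕ) :=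
  open Classical in (addable μ).filter (HasResidue k r)

/-- The removable cells of residue `r`. -/
def removableRes (k : ℕ) (r : Fin (k + 1)) (μ : YoungDiagram) : Finset (ℕ × ℕ) :=
  open Classical in (removable μ).filter (HasResidue k r)

/-- `μ` with all its addable cells of residue `r` added. -/
def addAll (k : ℕ) (r : Fin (k + 1)) (μ : YoungDiagram) : YoungDiagram where
  cells := μ.cells ∪ addableRes k r μ
  isLowerSet := by
    classical
    intro a b hba ha
    simp only [Finset.coe_union, Set.mem_union, Finset.mem_coe] at ha ⊢
    rcases ha with ha | ha
    · exact Or.inl (μ.isLowerSet hba ha)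
    · have h := ((mem_addable μ a).1 (Finset.mem_filter.1 ha).1).2 hba (Set.mem_insert _ _)
      rcases h with rfl | h
      · exact Or.inr ha
      · exact Or.inl h

/-- `μ` with all its removable cells of residue `r` removed. -/
def removeAll (k : ℕ) (r : Fin (k + 1)) (μ : YoungDiagram) : YoungDiagram where
  cells := μ.cells \ removableRes k r μ
  isLowerSet := by
    classical
    intro a b hba ha
    simp only [Finset.coe_sdiff, Set.mem_sdiff, Finset.mem_coe] at ha ⊢
    refine ⟨μ.isLowerSet hba ha.1, fun hb => ?_⟩
    have h := (Finset.mem_filter.1 (Finset.mem_filter.1 hb).1).2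
    have hab : a ≠ b := by
      rintro rfl
      exact ha.2 hb
    exact (h hba ⟨ha.1, by simpa using hab⟩).2 rfl

/-- The action of the generator `s_r` on `(k+1)`-cores: add all addable cells of residue `r` if
there are any; otherwise remove all removable cells of residue `r` (this is `μ` itself if there
are none). It is only ever applied to diagrams obtained from the empty one by such steps, all of
which are `(k+1)`-cores. -/
def coreGen (k : ℕ) (r : Fin (k + 1)) (μ : YoungDiagram) : YoungDiagram :=
  open Classical in
  if (addableRes k r μ).Nonempty then addAll k r μ else removeAll k r μ

/-- `μ = w ∅`: for some expression `w = s_{a_1} ⋯ s_{a_n}`, the diagram `μ` is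
`s_{a_1} (⋯ (s_{a_n} ∅))`. -/
def IsCoreOf (k : ℕ) (w : AffineA.W k) (μ : YoungDiagram) : Prop :=
  ∃ l : List (Fin (k + 1)),
    (l.map (AffineA.gen k)).prod = (w : Equiv.Perm (AffineA.V k)) ∧
      l.foldr (coreGen k) ⊥ = μ

/-- The hook length of a cell `(a, b)` of `μ`. -/
def hook (μ : YoungDiagram) (a b : ℕ) : ℕ := (μ.rowLen a - b) + (μ.colLen b - a) - 1

/-- The number of cells in row `a` of `μ` with hook length less than `k + 1`. -/
def shortHooks (k : ℕ) (μ : YoungDiagram) (a : ℕ) : ℕ :=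
  ((Finset.range (μ.rowLen a)).filter fun b => hook μ a b < k + 1).card

/-- The partition `lam` corresponds to the alcove `A_w`: it is the image `𝔭(w ∅)` of the core `w ∅`
under the map that counts in each row the cells with hook length less than `k + 1`. -/
def CorrespondsTo (k : ℕ) (lam : YoungDiagram) (w : AffineA.W k) : Prop :=
  ∃ μ, IsCoreOf k w μ ∧ ∀ a, lam.rowLen a = shortHooks k μ a

/-- All parts are at most `k`. -/
def IsKBounded (k : ℕ) (lam : YoungDiagram) : Prop := ∀ a, lam.rowLen a ≤ k

/-- The rectangle `R_i = (i^{k+1-i})`, for `1 ≤ i ≤ k`: `k + 1 - i` rows of length `i`. -/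
def rect (k i : ℕ) : YoungDiagram where
  cells := Finset.range (k + 1 - i) ×ˢ Finset.range i
  isLowerSet := by
    intro a b hba ha
    simp only [Finset.mem_coe, Finset.mem_product, Finset.mem_range] at ha ⊢
    exact ⟨lt_of_le_of_lt hba.1 ha.1, lt_of_le_of_lt hba.2 ha.2⟩

/-- The union `lam ∪ mu` of partitions: the parts of both, arranged in non-increasing order. -/
def union (lam mu : YoungDiagram) : YoungDiagram :=
  YoungDiagram.ofRowLens (Multiset.sort (lam.rowLens + mu.rowLens : Multiset ℕ) (· ≥ ·))
    (Multiset.pairwise_sort _ _).sortedGE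

/-- The union `R_{i_1} ∪ ⋯ ∪ R_{i_n}`; it is empty for `n = 0`. -/
def rectUnion (k : ℕ) {n : ℕ} (i : Fin n → ℕ) : YoungDiagram :=
  (List.ofFn fun j => rect k (i j)).foldr union ⊥

end KBounded

end

/-!
In the coordinates with `α_j = e_j - e_{j+1}`, extended from `0, …, k` to all integers by
`x_{j+k+1} = x_j - 1`, the generators of `W` permute positions, so `w` becomes a bijection `u` of
`ℤ` commuting with the shift by `k + 1`. The same generators act on the abacus of a core, and the
beads of `w ∅` are the images under `u` of the negative integers.

Testing the alcove at its barycentre, dominance says that `u 0, …, u k` increase, and lying below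
`H_{φ,m}` says that `u k - u 0 < (k + 1) m`. A row has at most as many short hooks as there are
`i ≤ k` with `u i` below its bead, so column `b` of `λ` is at most the number of beads beyond `u b`.
With `d_i = ⌊(u i - u 0) / (k + 1)⌋` this number is at most the sum of `d_i - d_b` over
`b < i ≤ k`. Slicing the sum by levels `t < m - 1`, level `t` contributes only if `d_b ≤ t`, and
then at most `#{i ≤ k | t < d_i}`, which is bounded by column `b` of the rectangle with
`#{i ≤ k | d_i ≤ t}` columns.
-/

noncomputable section

namespace AffineA

section AffinePermutations

variable {n : ℤ}

/-- The group of affine permutations of period `n`: the bijections `u` of the integers such that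
`u (j + n) = u j + n`. -/
def affinePerms (n : ℤ) : Subgroup (Equiv.Perm ℤ) := Subgroup.centralizer {Equiv.addRight n}

theorem mem_affinePerms_iff {u : Equiv.Perm ℤ} :
    u ∈ affinePerms n ↔ ∀ j, u (j + n) = u j + n := by
  simp only [affinePerms, Subgroup.mem_centralizer_singleton_iff, Equiv.Perm.ext_iff,
    Equiv.Perm.mul_apply, Equiv.coe_addRight]

theorem apply_add_mul {u : Equiv.Perm ℤ} (hu : u ∈ affinePerms n) (j q : ℤ) :
    u (j + n * q) = u j + n * q := by
  have hcomm : Commute u (Equiv.addRight n) := Subgroup.mem_centralizer_singleton_iff.1 hu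
  have h := Equiv.Perm.congr_fun (hcomm.zpow_right q).eq j
  simpa [mul_comm] using h

theorem exists_window_representative {u : Equiv.Perm ℤ} (hn : 0 < n) (hu : u ∈ affinePerms n)
    (x : ℤ) :
    ∃ i : ℕ, i < n ∧ ∃ q : ℤ, x = u i - n * q ∧ (x ∈ u '' Set.Iio 0 ↔ 0 < q) := by
  obtain ⟨y, rfl⟩ := u.surjective x
  obtain ⟨i, hi⟩ := Int.eq_ofNat_of_zero_le (Int.emod_nonneg y hn.ne')
  have hy : y = i + n * (y / n) := by rw [← hi, Int.emod_add_mul_ediv]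
  refine ⟨i, hi ▸ Int.emod_lt_of_pos y hn, -(y / n), ?_, ?_⟩
  · rw [mul_neg, sub_neg_eq_add, ← apply_add_mul hu, ← hy]
  · rw [u.injective.mem_set_image, Set.mem_Iio, neg_pos, Int.ediv_lt_iff_lt_mul hn, zero_mul]

/-- The affine permutation exchanging `j - 1` and `j` for every `j ≡ r` modulo `n`. If `n ∣ 1`
these transpositions are not disjoint, and the definition gives the identity instead. -/
def affineSwap (n r : ℤ) : Equiv.Perm ℤ :=
  Function.Involutive.toPerm
    (fun j => if n ∣ 1 then j else if n ∣ j - r then j - 1 else if n ∣ j + 1 - r then j + 1 else j)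
    (by
      intro j
      by_cases hn : n ∣ 1
      · simp only [if_pos hn]
      by_cases hj : n ∣ j - r
      · have : ¬ n ∣ j - 1 - r := fun h => hn (by simpa using dvd_sub hj h)
        simp [hn, hj, this]
      by_cases hj' : n ∣ j + 1 - r
      · simp only [if_neg hn, if_neg hj, if_pos hj', add_sub_cancel_right]
      · simp only [if_neg hn, if_neg hj, if_neg hj'])

theorem affineSwap_apply (n r j : ℤ) :
    affineSwap n r j =
      if n ∣ 1 then j else if n ∣ j - r then j - 1 else if n ∣ j + 1 - r then j + 1 else j :=
  rfl

theorem affineSwap_of_dvd {r j : ℤ} (hn : ¬ n ∣ 1) (hj : n ∣ j - r) :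
    affineSwap n r j = j - 1 := by
  rw [affineSwap_apply, if_neg hn, if_pos hj]

theorem affineSwap_of_dvd_succ {r j : ℤ} (hn : ¬ n ∣ 1) (hj : n ∣ j + 1 - r) :
    affineSwap n r j = j + 1 := by
  have : ¬ n ∣ j - r := fun h => hn (by simpa using dvd_sub hj h)
  rw [affineSwap_apply, if_neg hn, if_neg this, if_pos hj]

theorem affineSwap_of_not_dvd {r j : ℤ} (hj : ¬ n ∣ j - r) (hj' : ¬ n ∣ j + 1 - r) :
    affineSwap n r j = j := by
  simp only [affineSwap_apply, if_neg hj, if_neg hj', ite_self]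

theorem affineSwap_affineSwap (n r j : ℤ) : affineSwap n r (affineSwap n r j) = j :=
  Function.Involutive.toPerm_involutive _ j

theorem affineSwap_mem (n r : ℤ) : affineSwap n r ∈ affinePerms n := by
  refine mem_affinePerms_iff.2 fun j => ?_
  have h : n ∣ j + n - r ↔ n ∣ j - r := by rw [add_sub_right_comm, dvd_add_self_right]
  have h' : n ∣ j + n + 1 - r ↔ n ∣ j + 1 - r := by
    rw [add_right_comm, add_sub_right_comm, dvd_add_self_right]
  simp only [affineSwap_apply, h, h']
  split_ifs <;> ring

/-- The affine permutation of period `k + 1` given by a word in the generators. -/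
def wordPerm (k : ℕ) (l : List (Fin (k + 1))) : Equiv.Perm ℤ :=
  (l.map fun r => affineSwap (k + 1) (r : ℤ)).prod

theorem wordPerm_mem (k : ℕ) (l : List (Fin (k + 1))) : wordPerm k l ∈ affinePerms (k + 1) :=
  Subgroup.list_prod_mem _ fun _ hu => by
    obtain ⟨r, -, rfl⟩ := List.mem_map.1 hu
    exact affineSwap_mem _ _

end AffinePermutations

theorem dvd_sub_iff_emod_eq {n j r : ℤ} (h0 : 0 ≤ r) (hr : r < n) : n ∣ j - r ↔ j % n = r := by
  rw [← Int.modEq_iff_dvd, Int.ModEq, Int.emod_eq_of_lt h0 hr, eq_comm]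

section Coordinates

variable {k : ℕ}

/-- The coefficient of the `j`-th simple root, extended by zero to all integers `j`. -/
def coeff (j : ℤ) : V k →ₗ[ℝ] ℝ := ∑ i : Fin k, if (i : ℤ) = j then LinearMap.proj i else 0

theorem coeff_apply (j : ℤ) (x : V k) :
    coeff j x = ∑ i : Fin k, if (i : ℤ) = j then x i else 0 := by
  simp only [coeff, LinearMap.sum_apply]
  exact Finset.sum_congr rfl fun i _ => by split_ifs <;> rfl

theorem coeff_coe (i : Fin k) (x : V k) : coeff i x = x i := by
  simp [coeff_apply, ← Fin.ext_iff]

theorem coeff_of_neg {j : ℤ} (hj : j < 0) (x : V k) : coeff j x = 0 := by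
  rw [coeff_apply]
  exact Finset.sum_eq_zero fun i _ => if_neg (by omega)

theorem coeff_of_ge {j : ℤ} (hj : k ≤ j) (x : V k) : coeff j x = 0 := by
  rw [coeff_apply]
  exact Finset.sum_eq_zero fun i _ => if_neg (by omega)

theorem coeff_simpleRoot (j : ℤ) (i : Fin k) :
    coeff j (simpleRoot k i) = if j = i then 1 else 0 := by
  rw [coeff_apply, Finset.sum_eq_single i] <;> simp +contextual [simpleRoot, eq_comm]

theorem coeff_highestRoot (j : ℤ) :
    coeff j (highestRoot k) = if 0 ≤ j ∧ j < k then 1 else 0 := by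
  split_ifs with h
  · lift j to ℕ using h.1
    rw [show (j : ℤ) = ((⟨j, by omega⟩ : Fin k) : ℕ) from rfl, coeff_coe]
    simp [highestRoot, simpleRoot, Finset.sum_apply, Pi.single_apply]
  · rcases lt_or_ge j 0 with hj | hj
    · exact coeff_of_neg hj _
    · exact coeff_of_ge (by omega) _

theorem form_simpleRoot (i : Fin k) (x : V k) :
    form k (simpleRoot k i) x = 2 * coeff i x - coeff (i - 1) x - coeff (i + 1) x := by
  suffices form k (simpleRoot k i) =
      2 • coeff (i : ℤ) - coeff ((i : ℤ) - 1) - coeff ((i : ℤ) + 1) by simp [this]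
  refine LinearMap.pi_ext' fun j => LinearMap.ext_ring ?_
  have hform : form k (simpleRoot k i) (Pi.single j 1) =
      if i = j then (2 : ℝ) else if (i : ℕ) + 1 = j ∨ (j : ℕ) + 1 = i then -1 else 0 :=
    Matrix.toBilin'_single _ i j
  have hcoeff (p : ℤ) : coeff p (Pi.single j 1 : V k) = if p = j then 1 else 0 :=
    coeff_simpleRoot p j
  simp only [LinearMap.comp_apply, LinearMap.sub_apply, LinearMap.smul_apply,
    LinearMap.single_apply, hform, hcoeff, Fin.ext_iff]
  split_ifs <;> first | omega | norm_num

theorem form_highestRoot (x : V k) :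
    form k (highestRoot k) x = coeff 0 x + coeff (k - 1) x := by
  let step : ℕ → ℝ := fun i => coeff (i : ℤ) x - coeff ((i : ℤ) - 1) x
  calc form k (highestRoot k) x
      = ∑ i : Fin k, (step i - step (i + 1)) := by
        simp only [highestRoot, map_sum, LinearMap.sum_apply, form_simpleRoot, step]
        refine Finset.sum_congr rfl fun i _ => ?_
        rw [Nat.cast_succ, add_sub_cancel_right]
        ring
    _ = step 0 - step k := by
        rw [Fin.sum_univ_eq_sum_range fun i => step i - step (i + 1), Finset.sum_range_sub']
    _ = coeff 0 x + coeff (k - 1) x := by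
        simp only [step, Nat.cast_zero, coeff_of_ge le_rfl,
          coeff_of_neg (show (0 : ℤ) - 1 < 0 by norm_num)]
        ring

theorem form_simpleRoot_self (i : Fin k) : form k (simpleRoot k i) (simpleRoot k i) = 2 := by
  simp [form_simpleRoot, coeff_simpleRoot]

theorem form_highestRoot_self (hk : 1 ≤ k) : form k (highestRoot k) (highestRoot k) = 2 := by
  rw [form_highestRoot, coeff_highestRoot, coeff_highestRoot, if_pos (by omega),
    if_pos (by omega)]
  norm_num

/-- The Euclidean coordinates, in which `α_j = e_j - e_{j+1}`, repeated with period `k + 1`. -/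
def periodicCoord (j : ℤ) : V k →ₗ[ℝ] ℝ := coeff (j % (k + 1)) - coeff (j % (k + 1) - 1)

/-- The Euclidean coordinates, extended from `0, …, k` to all integers `j` by
`affineCoord x (j + (k + 1)) = affineCoord x j - 1`: in these the generators of `W` permute
positions. -/
def affineCoord (x : V k) (j : ℤ) : ℝ := periodicCoord j x - (j / (k + 1) : ℤ)

theorem affineCoord_add_mul (x : V k) (j q : ℤ) :
    affineCoord x (j + (k + 1) * q) = affineCoord x j - q := by
  have hn : (k + 1 : ℤ) ≠ 0 := by omega
  simp only [affineCoord, periodicCoord, Int.add_mul_emod_self_left, Int.add_mul_ediv_left _ _ hn]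
  push_cast
  ring

theorem affineCoord_of_mem {j : ℤ} (h0 : 0 ≤ j) (hk : j ≤ k) (x : V k) :
    affineCoord x j = coeff j x - coeff (j - 1) x := by
  simp [affineCoord, periodicCoord, Int.emod_eq_of_lt h0 (show j < k + 1 by omega),
    Int.ediv_eq_zero_of_lt h0 (show j < k + 1 by omega)]

theorem affineCoord_sub_smul (x v : V k) (c : ℝ) (j : ℤ) :
    affineCoord (x - c • v) j = affineCoord x j - c * periodicCoord j v := by
  simp only [affineCoord, map_sub, map_smul, smul_eq_mul]
  ring

theorem affineCoord_pred_sub_of_dvd (x : V k) {j r : ℤ} (h : (k + 1 : ℤ) ∣ j - r) :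
    affineCoord x (j - 1) - affineCoord x j = affineCoord x (r - 1) - affineCoord x r := by
  obtain ⟨q, hq⟩ := h
  obtain rfl : j = r + (k + 1) * q := by linarith
  rw [add_sub_right_comm, affineCoord_add_mul, affineCoord_add_mul]
  ring

theorem form_simpleRoot_eq_affineCoord (i : Fin k) (x : V k) :
    form k (simpleRoot k i) x = affineCoord x i - affineCoord x (i + 1) := by
  rw [form_simpleRoot, affineCoord_of_mem (by omega) (by omega),
    affineCoord_of_mem (by omega) (by omega), add_sub_cancel_right]
  ring

theorem form_highestRoot_eq_affineCoord (x : V k) :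
    form k (highestRoot k) x = affineCoord x 0 - affineCoord x k := by
  rw [form_highestRoot, affineCoord_of_mem le_rfl (by omega), affineCoord_of_mem (by omega) le_rfl,
    coeff_of_ge le_rfl, coeff_of_neg (show (0 : ℤ) - 1 < 0 by norm_num)]
  ring

/-- The vector parts of the affine simple roots: `s_r` is the reflection along `affineRoot k r`. -/
def affineRoot (k : ℕ) : Fin (k + 1) → V k := Fin.cases (-highestRoot k) (simpleRoot k)

theorem gen_apply (hk : 1 ≤ k) (r : Fin (k + 1)) (x : V k) :
    gen k r x = x - (affineCoord x (r - 1) - affineCoord x r) • affineRoot k r := by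
  refine Fin.cases ?_ (fun i => ?_) r
  · change x - (2 * (form k (highestRoot k) x - 1) / form k (highestRoot k) (highestRoot k)) •
      highestRoot k = x - (affineCoord x (0 - 1) - affineCoord x 0) • -highestRoot k
    have hlast : affineCoord x (0 - 1) = affineCoord x k + 1 := by
      rw [show (0 - 1 : ℤ) = k + (k + 1) * (-1) by ring, affineCoord_add_mul]
      simp
    rw [form_highestRoot_self hk, mul_div_cancel_left₀ _ two_ne_zero,
      form_highestRoot_eq_affineCoord, hlast, smul_neg, ← neg_smul]
    congr 2
    ring
  · change x - (2 * (form k (simpleRoot k i) x - 0) / form k (simpleRoot k i) (simpleRoot k i)) •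
      simpleRoot k i = x - _ • simpleRoot k i
    rw [form_simpleRoot_self, sub_zero, mul_div_cancel_left₀ _ two_ne_zero,
      form_simpleRoot_eq_affineCoord]
    simp

theorem periodicCoord_affineRoot (r : Fin (k + 1)) (j : ℤ) :
    periodicCoord j (affineRoot k r) =
      (if (k + 1 : ℤ) ∣ j + 1 - r then 1 else 0) - if (k + 1 : ℤ) ∣ j - r then 1 else 0 := by
  have h0 := Int.emod_nonneg j (show (k + 1 : ℤ) ≠ 0 by omega)
  have hlt := Int.emod_lt_of_pos j (show (0 : ℤ) < k + 1 by omega)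
  refine Fin.cases ?_ (fun i => ?_) r
  · have hlast : (k + 1 : ℤ) ∣ j + 1 ↔ j % (k + 1) = k := by
      rw [← dvd_sub_iff_emod_eq (by omega) (by omega), ← dvd_sub_self_right,
        add_sub_add_right_eq_sub]
    have hfirst : (k + 1 : ℤ) ∣ j ↔ j % (k + 1) = 0 := Int.dvd_iff_emod_eq_zero
    simp only [periodicCoord, affineRoot, Fin.cases_zero, LinearMap.sub_apply, map_neg,
      coeff_highestRoot, Fin.val_zero, Nat.cast_zero, sub_zero, hlast, hfirst]
    split_ifs <;> first | omega | norm_num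
  · have hi : (k + 1 : ℤ) ∣ j + 1 - i.succ ↔ j % (k + 1) = i := by
      rw [← dvd_sub_iff_emod_eq (by omega) (by omega), Fin.val_succ, Nat.cast_succ,
        add_sub_add_right_eq_sub]
    have hi' : (k + 1 : ℤ) ∣ j - i.succ ↔ j % (k + 1) - 1 = i := by
      rw [dvd_sub_iff_emod_eq (by omega) (by omega), Fin.val_succ, Nat.cast_succ, sub_eq_iff_eq_add]
    simp only [periodicCoord, affineRoot, Fin.cases_succ, LinearMap.sub_apply, coeff_simpleRoot,
      hi, hi']

theorem not_succ_dvd_one (hk : 1 ≤ k) : ¬ (k + 1 : ℤ) ∣ 1 := fun h => by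
  have := Int.le_of_dvd one_pos h
  omega

theorem affineCoord_gen (hk : 1 ≤ k) (r : Fin (k + 1)) (x : V k) (j : ℤ) :
    affineCoord (gen k r x) j = affineCoord x (affineSwap (k + 1) r j) := by
  have hn := not_succ_dvd_one hk
  rw [gen_apply hk, affineCoord_sub_smul, periodicCoord_affineRoot]
  by_cases hj : (k + 1 : ℤ) ∣ j - r
  · have hj' : ¬ (k + 1 : ℤ) ∣ j + 1 - r := fun h => hn (by simpa using dvd_sub h hj)
    rw [affineSwap_of_dvd hn hj, if_pos hj, if_neg hj', ← affineCoord_pred_sub_of_dvd x hj]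
    ring
  by_cases hj' : (k + 1 : ℤ) ∣ j + 1 - r
  · rw [affineSwap_of_dvd_succ hn hj', if_neg hj, if_pos hj', ← affineCoord_pred_sub_of_dvd x hj',
      add_sub_cancel_right]
    ring
  · rw [affineSwap_of_not_dvd hj hj', if_neg hj, if_neg hj', sub_zero, mul_zero, sub_zero]

theorem affineCoord_wordPerm (hk : 1 ≤ k) (l : List (Fin (k + 1))) (x : V k) (j : ℤ) :
    affineCoord ((l.map (gen k)).prod x) (wordPerm k l j) = affineCoord x j := by
  induction l with
  | nil => rfl
  | cons r l ih =>
    change affineCoord (gen k r ((l.map (gen k)).prod x))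
      (affineSwap (k + 1) r (wordPerm k l j)) = _
    rw [affineCoord_gen hk, affineSwap_affineSwap, ih]

theorem affineCoord_inv_apply (hk : 1 ≤ k) {l : List (Fin (k + 1))} {w : W k}
    (hl : (l.map (gen k)).prod = w) (x : V k) (j : ℤ) :
    affineCoord ((w⁻¹ : Equiv.Perm (V k)) x) j = affineCoord x (wordPerm k l j) := by
  rw [← affineCoord_wordPerm hk l, hl, ← Equiv.Perm.mul_apply, mul_inv_cancel, Equiv.Perm.one_apply]

end Coordinates

section Alcoves

variable {k : ℕ}

/-- The barycentre `ρ^∨ / (k + 1)` of the fundamental alcove. Its affine coordinates are in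
arithmetic progression, so those of its images under `W` determine the permutation. -/
def barycentre (k : ℕ) : V k := fun i => (i + 1) * (k - i) / (2 * (k + 1))

theorem coeff_barycentre {j : ℤ} (h0 : -1 ≤ j) (hk : j ≤ k) :
    coeff j (barycentre k) = (j + 1) * (k - j) / (2 * (k + 1)) := by
  rcases h0.eq_or_lt with rfl | h0
  · simp [coeff_of_neg]
  rcases hk.eq_or_lt with rfl | hk
  · simp [coeff_of_ge]
  lift j to ℕ using by omega
  exact coeff_coe ⟨j, by omega⟩ (barycentre k)

theorem affineCoord_barycentre (j : ℤ) :
    affineCoord (barycentre k) j = (k / 2 - j) / (k + 1) := by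
  have h0 := Int.emod_nonneg j (show (k + 1 : ℤ) ≠ 0 by omega)
  have hlt := Int.emod_lt_of_pos j (show (0 : ℤ) < k + 1 by omega)
  have hj : ((j % (k + 1) : ℤ) : ℝ) + (k + 1) * (j / (k + 1) : ℤ) = j := by
    exact_mod_cast Int.emod_add_mul_ediv j (k + 1)
  have : (k + 1 : ℝ) ≠ 0 := by positivity
  rw [affineCoord, periodicCoord, LinearMap.sub_apply, coeff_barycentre (by omega) (by omega),
    coeff_barycentre (by omega) (by omega), ← hj]
  push_cast
  field_simp
  ring

theorem affineCoord_barycentre_sub (i j : ℤ) :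
    affineCoord (barycentre k) i - affineCoord (barycentre k) j = (j - i : ℤ) / (k + 1) := by
  rw [affineCoord_barycentre, affineCoord_barycentre, ← sub_div]
  push_cast
  ring

theorem barycentre_mem_fundamentalAlcove (k : ℕ) : barycentre k ∈ fundamentalAlcove k := by
  constructor
  · intro i
    rw [form_simpleRoot_eq_affineCoord, affineCoord_barycentre_sub, add_sub_cancel_left]
    positivity
  · rw [form_highestRoot_eq_affineCoord, affineCoord_barycentre_sub, div_le_one (by positivity)]
    simp

theorem wordPerm_monotoneOn (hk : 1 ≤ k) {l : List (Fin (k + 1))} {w : W k}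
    (hl : (l.map (gen k)).prod = w) (hdom : alcove k w ⊆ dominantChamber k) :
    MonotoneOn (fun i : ℕ => wordPerm k l i) (Set.Iic k) := by
  refine monotoneOn_of_le_succ Set.ordConnected_Iic fun i _ _ hi => ?_
  have h := hdom (Set.mem_image_of_mem _ (barycentre_mem_fundamentalAlcove k))
    ⟨i, Nat.lt_of_succ_le hi⟩
  rw [form_simpleRoot_eq_affineCoord, affineCoord_inv_apply hk hl, affineCoord_inv_apply hk hl,
    affineCoord_barycentre_sub, le_div_iff₀ (by positivity), zero_mul] at h
  exact sub_nonneg.1 (Int.cast_nonneg_iff.1 h)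

theorem wordPerm_sub_lt (hk : 1 ≤ k) {m : ℕ} {l : List (Fin (k + 1))} {w : W k}
    (hl : (l.map (gen k)).prod = w) (hbelow : alcove k w ⊆ below k m) :
    wordPerm k l k - wordPerm k l 0 < (k + 1) * m := by
  have hle : wordPerm k l k - wordPerm k l 0 ≤ (k + 1) * m := by
    have h : form k (highestRoot k) _ ≤ m :=
      hbelow (Set.mem_image_of_mem _ (barycentre_mem_fundamentalAlcove k))
    rw [form_highestRoot_eq_affineCoord, affineCoord_inv_apply hk hl, affineCoord_inv_apply hk hl,
      affineCoord_barycentre_sub, div_le_iff₀ (by positivity), mul_comm] at h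
    exact_mod_cast h
  refine hle.lt_of_ne fun heq => ?_
  have hshift : wordPerm k l k = wordPerm k l (0 + (k + 1) * m) := by
    rw [apply_add_mul (wordPerm_mem k l), ← heq, add_sub_cancel]
  have hkm : (k + 1 : ℤ) ∣ k := ⟨m, by simpa using (wordPerm k l).injective hshift⟩
  have := Int.le_of_dvd (by omega) hkm
  omega

end Alcoves

end AffineA

namespace KBounded

open AffineA

section Lengths

variable {μ ν : YoungDiagram}

theorem rowLen_eq_of_mem_iff {a n : ℕ} (h : ∀ b, (a, b) ∈ μ ↔ b < n) : μ.rowLen a = n :=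
  eq_of_forall_lt_iff fun b => by rw [← YoungDiagram.mem_iff_lt_rowLen, h]

theorem colLen_eq_of_mem_iff {b n : ℕ} (h : ∀ a, (a, b) ∈ μ ↔ a < n) : μ.colLen b = n :=
  eq_of_forall_lt_iff fun a => by rw [← YoungDiagram.mem_iff_lt_colLen, h]

theorem lt_colLen_iff_lt_rowLen {a b : ℕ} : a < μ.colLen b ↔ b < μ.rowLen a := by
  rw [← YoungDiagram.mem_iff_lt_colLen, YoungDiagram.mem_iff_lt_rowLen]

theorem rowLen_bot (a : ℕ) : (⊥ : YoungDiagram).rowLen a = 0 :=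
  rowLen_eq_of_mem_iff fun b => by simp

theorem colLen_bot (b : ℕ) : (⊥ : YoungDiagram).colLen b = 0 :=
  colLen_eq_of_mem_iff fun a => by simp

theorem le_of_colLen_le (h : ∀ b, μ.colLen b ≤ ν.colLen b) : μ ≤ ν := fun ⟨_, b⟩ hab =>
  YoungDiagram.mem_iff_lt_colLen.2 ((YoungDiagram.mem_iff_lt_colLen.1 hab).trans_le (h b))

theorem colLen_eq_zero_of_isKBounded {k b : ℕ} (hμ : IsKBounded k μ) (hb : k ≤ b) :
    μ.colLen b = 0 :=
  Nat.eq_zero_of_not_pos fun h =>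
    ((lt_colLen_iff_lt_rowLen.1 h).trans_le (hμ 0)).not_ge hb

theorem colLen_eq_countP (μ : YoungDiagram) (b : ℕ) : μ.colLen b = μ.rowLens.countP (b < ·) := by
  have hcount : μ.rowLens.countP (b < ·) =
      ((Finset.range (μ.colLen 0)).filter (b < μ.rowLen ·)).card := by
    rw [YoungDiagram.rowLens, List.countP_map, Finset.card_def, Finset.filter_val,
      ← Multiset.countP_eq_card_filter, Finset.range_val, Multiset.range, Multiset.coe_countP]
    rfl
  have hfilter : (Finset.range (μ.colLen 0)).filter (b < μ.rowLen ·) =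
      Finset.range (μ.colLen b) := by
    ext a
    have := μ.colLen_anti 0 b (Nat.zero_le b)
    simp only [Finset.mem_filter, Finset.mem_range, ← lt_colLen_iff_lt_rowLen]
    omega
  rw [hcount, hfilter, Finset.card_range]

theorem colLen_union (μ ν : YoungDiagram) (b : ℕ) :
    (union μ ν).colLen b = μ.colLen b + ν.colLen b := by
  have hperm : (Multiset.sort (μ.rowLens + ν.rowLens : Multiset ℕ) (· ≥ ·)).Perm
      (μ.rowLens ++ ν.rowLens) := by
    rw [← Multiset.coe_eq_coe, Multiset.sort_eq, Multiset.coe_add]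
  have hpos : ∀ x ∈ Multiset.sort (μ.rowLens + ν.rowLens : Multiset ℕ) (· ≥ ·), 0 < x := by
    intro x hx
    rw [hperm.mem_iff, List.mem_append] at hx
    exact hx.elim (μ.pos_of_mem_rowLens x) (ν.pos_of_mem_rowLens x)
  rw [colLen_eq_countP, union, YoungDiagram.rowLens_ofRowLens_eq_self hpos, hperm.countP_eq,
    List.countP_append, ← colLen_eq_countP, ← colLen_eq_countP]

theorem colLen_foldr_union (L : List YoungDiagram) (b : ℕ) :
    (L.foldr union ⊥).colLen b = (L.map fun μ => μ.colLen b).sum := by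
  induction L with
  | nil => exact colLen_bot b
  | cons μ L ih => rw [List.foldr_cons, colLen_union, ih, List.map_cons, List.sum_cons]

theorem colLen_rect (k i b : ℕ) : (rect k i).colLen b = if b < i then k + 1 - i else 0 := by
  refine colLen_eq_of_mem_iff fun a => ?_
  rw [← YoungDiagram.mem_cells]
  simp only [rect, Finset.mem_product, Finset.mem_range]
  split_ifs <;> omega

theorem colLen_rectUnion (k : ℕ) {n : ℕ} (i : Fin n → ℕ) (b : ℕ) :
    (rectUnion k i).colLen b = ∑ t, if b < i t then k + 1 - i t else 0 := by
  simp only [rectUnion, colLen_foldr_union, List.map_ofFn, List.sum_ofFn, Function.comp_apply,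
    colLen_rect]

end Lengths

section Abacus

variable {μ : YoungDiagram}

/-- The position of the bead of row `a` on the abacus (Maya diagram) of `μ`; the empty diagram has
its beads at the negative integers. -/
def bead (μ : YoungDiagram) (a : ℕ) : ℤ := μ.rowLen a - a - 1

/-- The set of bead positions of `μ`, which determines `μ`. -/
def beads (μ : YoungDiagram) : Set ℤ := Set.range (bead μ)

/-- The position of the empty place of column `b` on the abacus of `μ`. -/
def gap (μ : YoungDiagram) (b : ℕ) : ℤ := b - μ.colLen b

theorem bead_strictAnti (μ : YoungDiagram) : StrictAnti (bead μ) := fun a b hab => by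
  have := μ.rowLen_anti a b hab.le
  unfold bead
  omega

theorem gap_strictMono (μ : YoungDiagram) : StrictMono (gap μ) := fun a b hab => by
  have := μ.colLen_anti a b hab.le
  unfold gap
  omega

theorem gap_notMem_beads (μ : YoungDiagram) (b : ℕ) : gap μ b ∉ beads μ := by
  rintro ⟨a, ha⟩
  have : a < μ.colLen b ↔ b < μ.rowLen a := lt_colLen_iff_lt_rowLen
  unfold bead gap at ha
  omega

theorem gap_lt_bead {a b : ℕ} (hb : b < μ.rowLen a) : gap μ b < bead μ a := by
  have := lt_colLen_iff_lt_rowLen.2 hb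
  unfold bead gap
  omega

theorem hook_eq_bead_sub_gap {a b : ℕ} (hb : b < μ.rowLen a) :
    (hook μ a b : ℤ) = bead μ a - gap μ b := by
  have := lt_colLen_iff_lt_rowLen.2 hb
  unfold hook bead gap
  omega

theorem beads_bot : beads ⊥ = Set.Iio 0 := by
  ext x
  simp only [beads, bead, rowLen_bot, Set.mem_range, Set.mem_Iio]
  exact ⟨by rintro ⟨a, rfl⟩; omega, fun hx => ⟨(-x - 1).toNat, by omega⟩⟩

theorem bead_add_one_notMem_beads_iff {a : ℕ} :
    bead μ a + 1 ∉ beads μ ↔ ∀ c < a, μ.rowLen a < μ.rowLen c := by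
  constructor
  · intro h c hc
    by_contra! hle
    have h1 := μ.rowLen_anti c (a - 1) (by omega)
    have h2 := μ.rowLen_anti (a - 1) a (by omega)
    exact h ⟨a - 1, by unfold bead; omega⟩
  · rintro h ⟨c, hc⟩
    have hca : c < a := (bead_strictAnti μ).lt_iff_gt.1 (by omega)
    have := h c hca
    unfold bead at hc
    omega

theorem bead_sub_one_notMem_beads_iff {a : ℕ} :
    bead μ a - 1 ∉ beads μ ↔ ∀ c > a, μ.rowLen c < μ.rowLen a := by
  constructor
  · intro h c hc
    by_contra! hle
    have h1 := μ.rowLen_anti (a + 1) c hc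
    have h2 := μ.rowLen_anti a (a + 1) (by omega)
    exact h ⟨a + 1, by unfold bead; omega⟩
  · rintro h ⟨c, hc⟩
    have hca : a < c := (bead_strictAnti μ).lt_iff_gt.1 (by omega)
    have := h c hca
    unfold bead at hc
    omega

theorem mem_addable_iff {a b : ℕ} :
    (a, b) ∈ addable μ ↔ b = μ.rowLen a ∧ bead μ a + 1 ∉ beads μ := by
  rw [mem_addable, bead_add_one_notMem_beads_iff, YoungDiagram.mem_iff_lt_rowLen]
  constructor
  · rintro ⟨hab, hlower⟩
    have hmem {c d : ℕ} (hle : (c, d) ≤ (a, b)) (hne : (c, d) ≠ (a, b)) : d < μ.rowLen c :=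
      YoungDiagram.mem_iff_lt_rowLen.1
        ((hlower hle (Set.mem_insert _ _)).resolve_left hne)
    have hb : b = μ.rowLen a := by
      by_contra hne
      exact (hmem (c := a) (d := μ.rowLen a) ⟨le_rfl, by simpa using hab⟩
        (by simpa using Ne.symm hne)).false
    exact ⟨hb, fun c hc => hb ▸ hmem ⟨hc.le, le_rfl⟩ (by simp [hc.ne])⟩
  · rintro ⟨rfl, hrow⟩
    refine ⟨lt_irrefl _, ?_⟩
    rintro _ ⟨c, d⟩ hle (rfl | hy)
    · obtain ⟨hc, hd⟩ : c ≤ a ∧ d ≤ μ.rowLen a := hle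
      rcases hc.eq_or_lt with rfl | hc
      · rcases hd.eq_or_lt with rfl | hd
        · exact Set.mem_insert _ _
        · exact Or.inr (YoungDiagram.mem_iff_lt_rowLen.2 hd)
      · exact Or.inr (YoungDiagram.mem_iff_lt_rowLen.2 (hd.trans_lt (hrow c hc)))
    · exact Or.inr (μ.isLowerSet hle hy)

theorem mem_removable_iff {a b : ℕ} :
    (a, b) ∈ removable μ ↔ b + 1 = μ.rowLen a ∧ bead μ a - 1 ∉ beads μ := by
  classical
  rw [removable, Finset.mem_filter, YoungDiagram.mem_cells, YoungDiagram.mem_iff_lt_rowLen,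
    bead_sub_one_notMem_beads_iff]
  constructor
  · rintro ⟨hab, hlower⟩
    have hnotMem {c d : ℕ} (hle : (a, b) ≤ (c, d)) (hne : (c, d) ≠ (a, b)) : μ.rowLen c ≤ d := by
      by_contra! hlt
      exact (hlower hle ⟨YoungDiagram.mem_iff_lt_rowLen.2 hlt, hne⟩).2 rfl
    have hb : μ.rowLen a ≤ b + 1 := hnotMem ⟨le_rfl, b.le_succ⟩ (by simp)
    exact ⟨by omega, fun c hc => (hnotMem ⟨hc.le, le_rfl⟩ (by simp [hc.ne'])).trans_lt hab⟩
  · rintro ⟨hb, hrow⟩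
    refine ⟨by omega, μ.isLowerSet.erase ?_⟩
    rintro ⟨c, d⟩ hcd ⟨hc, hd⟩
    have hlt : d < μ.rowLen c := YoungDiagram.mem_iff_lt_rowLen.1 hcd
    change a ≤ c at hc
    change b ≤ d at hd
    rcases hc.eq_or_lt with rfl | hc
    · exact Prod.ext rfl (by simp only; omega)
    · have := hrow c hc
      omega

theorem hasResidue_iff {k : ℕ} {r : Fin (k + 1)} {c : ℕ × ℕ} :
    HasResidue k r c ↔ (k + 1 : ℤ) ∣ c.2 - c.1 - r := by
  rw [HasResidue, Int.modEq_comm, Int.modEq_iff_dvd]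

theorem mem_addableRes_iff {k : ℕ} {r : Fin (k + 1)} {a b : ℕ} :
    (a, b) ∈ addableRes k r μ ↔
      b = μ.rowLen a ∧ (k + 1 : ℤ) ∣ bead μ a + 1 - r ∧ bead μ a + 1 ∉ beads μ := by
  classical
  rw [addableRes, Finset.mem_filter, mem_addable_iff, hasResidue_iff, and_assoc]
  refine and_congr_right fun hb => ?_
  rw [and_comm, bead, sub_add_cancel, hb]

theorem mem_removableRes_iff {k : ℕ} {r : Fin (k + 1)} {a b : ℕ} :
    (a, b) ∈ removableRes k r μ ↔
      b + 1 = μ.rowLen a ∧ (k + 1 : ℤ) ∣ bead μ a - r ∧ bead μ a - 1 ∉ beads μ := by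
  classical
  rw [removableRes, Finset.mem_filter, mem_removable_iff, hasResidue_iff, and_assoc]
  refine and_congr_right fun hb => ?_
  have hbead : (b - a : ℤ) = bead μ a := by
    unfold bead
    omega
  rw [and_comm, hbead]

open Classical in
theorem bead_addAll (k : ℕ) (r : Fin (k + 1)) (μ : YoungDiagram) (a : ℕ) :
    bead (addAll k r μ) a =
      if (k + 1 : ℤ) ∣ bead μ a + 1 - r ∧ bead μ a + 1 ∉ beads μ then bead μ a + 1
      else bead μ a := by
  have hrow : (addAll k r μ).rowLen a = μ.rowLen a +
      if (k + 1 : ℤ) ∣ bead μ a + 1 - r ∧ bead μ a + 1 ∉ beads μ then 1 else 0 := by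
    refine rowLen_eq_of_mem_iff fun b => ?_
    rw [← YoungDiagram.mem_cells, addAll, Finset.mem_union, YoungDiagram.mem_cells,
      YoungDiagram.mem_iff_lt_rowLen, mem_addableRes_iff]
    split_ifs with h
    · rw [and_iff_left h]
      omega
    · simp only [h, and_false, or_false, add_zero]
  rw [bead, hrow]
  split_ifs
  · rw [bead, Nat.cast_succ]
    ring
  · rw [add_zero, bead]

open Classical in
theorem bead_removeAll (k : ℕ) (r : Fin (k + 1)) (μ : YoungDiagram) (a : ℕ) :
    bead (removeAll k r μ) a =
      if (k + 1 : ℤ) ∣ bead μ a - r ∧ bead μ a - 1 ∉ beads μ then bead μ a - 1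
      else bead μ a := by
  have hrow : (removeAll k r μ).rowLen a = μ.rowLen a -
      if (k + 1 : ℤ) ∣ bead μ a - r ∧ bead μ a - 1 ∉ beads μ then 1 else 0 := by
    refine rowLen_eq_of_mem_iff fun b => ?_
    rw [← YoungDiagram.mem_cells, removeAll, Finset.mem_sdiff, YoungDiagram.mem_cells,
      YoungDiagram.mem_iff_lt_rowLen, mem_removableRes_iff]
    split_ifs with h
    · rw [and_iff_left h]
      omega
    · simp only [h, and_false, not_false_eq_true, and_true, tsub_zero]
  rw [bead, hrow]
  split_ifs with h
  · have hpos : 0 < μ.rowLen a :=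
      (bead_sub_one_notMem_beads_iff.1 h.2 _ a.lt_succ_self).pos
    rw [bead, Nat.cast_pred hpos]
    ring
  · rw [tsub_zero, bead]

theorem mem_beads_addAll_iff {k : ℕ} {r : Fin (k + 1)} {x : ℤ} :
    x ∈ beads (addAll k r μ) ↔
      (x - 1 ∈ beads μ ∧ (k + 1 : ℤ) ∣ x - r ∧ x ∉ beads μ) ∨
      (x ∈ beads μ ∧ ((k + 1 : ℤ) ∣ x + 1 - r → x + 1 ∈ beads μ)) := by
  constructor
  · rintro ⟨a, rfl⟩
    rw [bead_addAll]
    split_ifs with h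
    · exact Or.inl ⟨⟨a, by ring⟩, h⟩
    · exact Or.inr ⟨⟨a, rfl⟩, fun hd => not_not.1 fun hn => h ⟨hd, hn⟩⟩
  · rintro (⟨⟨a, ha⟩, hd, hn⟩ | ⟨⟨a, rfl⟩, h⟩)
    · obtain rfl : x = bead μ a + 1 := by omega
      exact ⟨a, by rw [bead_addAll, if_pos ⟨hd, hn⟩]⟩
    · exact ⟨a, by rw [bead_addAll, if_neg fun hc => hc.2 (h hc.1)]⟩

theorem mem_beads_removeAll_iff {k : ℕ} {r : Fin (k + 1)} {x : ℤ} :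
    x ∈ beads (removeAll k r μ) ↔
      (x + 1 ∈ beads μ ∧ (k + 1 : ℤ) ∣ x + 1 - r ∧ x ∉ beads μ) ∨
      (x ∈ beads μ ∧ ((k + 1 : ℤ) ∣ x - r → x - 1 ∈ beads μ)) := by
  constructor
  · rintro ⟨a, rfl⟩
    rw [bead_removeAll]
    split_ifs with h
    · exact Or.inl (by simpa using ⟨⟨a, rfl⟩, h⟩)
    · exact Or.inr ⟨⟨a, rfl⟩, fun hd => not_not.1 fun hn => h ⟨hd, hn⟩⟩
  · rintro (⟨⟨a, ha⟩, hd, hn⟩ | ⟨⟨a, rfl⟩, h⟩)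
    · obtain rfl : x = bead μ a - 1 := by omega
      exact ⟨a, by rw [bead_removeAll, if_pos ⟨by simpa using hd, hn⟩]⟩
    · exact ⟨a, by rw [bead_removeAll, if_neg fun hc => hc.2 (h hc.1)]⟩

end Abacus

section Cores

variable {k : ℕ} {μ : YoungDiagram}

/-- The abacus form of being a `(k + 1)`-core: on every runner of the abacus with `k + 1` runners
the beads are flush. -/
def IsCore (k : ℕ) (μ : YoungDiagram) : Prop := ∀ x ∈ beads μ, x - (k + 1) ∈ beads μ

theorem IsCore.sub_mul_mem (hμ : IsCore k μ) {x : ℤ} (hx : x ∈ beads μ) (q : ℕ) :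
    x - (k + 1) * q ∈ beads μ := by
  induction q with
  | zero => simpa using hx
  | succ q ih =>
    convert hμ _ ih using 1
    push_cast
    ring

theorem isCore_of_beads_eq_image {u : Equiv.Perm ℤ} (hu : u ∈ affinePerms (k + 1))
    (hμ : beads μ = u '' Set.Iio 0) : IsCore k μ := by
  rw [IsCore, hμ]
  rintro _ ⟨j, hj, rfl⟩
  refine ⟨j + (k + 1) * (-1), ?_, by rw [apply_add_mul hu]; ring⟩
  rw [Set.mem_Iio] at hj ⊢
  omega

/-- A core cannot have both an addable and a removable cell of the same residue. -/
theorem IsCore.sub_one_mem_of_addableRes_nonempty {r : Fin (k + 1)} (hμ : IsCore k μ)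
    (hadd : (addableRes k r μ).Nonempty) {x : ℤ} (hr : (k + 1 : ℤ) ∣ x - r) (hx : x ∈ beads μ) :
    x - 1 ∈ beads μ := by
  obtain ⟨⟨a, b⟩, hab⟩ := hadd
  obtain ⟨-, hr', hfree⟩ := mem_addableRes_iff.1 hab
  obtain ⟨q, hq⟩ : (k + 1 : ℤ) ∣ bead μ a + 1 - x := by simpa using dvd_sub hr' hr
  obtain ⟨t, rfl | rfl⟩ := q.eq_nat_or_neg
  · convert hμ.sub_mul_mem ⟨a, rfl⟩ t using 1
    linarith
  · refine absurd ?_ hfree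
    convert hμ.sub_mul_mem hx t using 1
    linarith

theorem add_one_mem_of_addableRes_not_nonempty {r : Fin (k + 1)}
    (hadd : ¬ (addableRes k r μ).Nonempty) {x : ℤ} (hr : (k + 1 : ℤ) ∣ x + 1 - r)
    (hx : x ∈ beads μ) : x + 1 ∈ beads μ := by
  obtain ⟨a, rfl⟩ := hx
  by_contra hfree
  exact hadd ⟨(a, μ.rowLen a), mem_addableRes_iff.2 ⟨rfl, hr, hfree⟩⟩

theorem mem_affineSwap_image_iff {n r x : ℤ} {B : Set ℤ} :
    x ∈ affineSwap n r '' B ↔ affineSwap n r x ∈ B := by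
  rw [Equiv.image_eq_preimage_symm]
  rfl

theorem beads_coreGen (hk : 1 ≤ k) (r : Fin (k + 1)) (hμ : IsCore k μ) :
    beads (coreGen k r μ) = affineSwap (k + 1) r '' beads μ := by
  ext x
  rw [mem_affineSwap_image_iff, coreGen]
  have hn := not_succ_dvd_one hk
  have hexcl (h : (k + 1 : ℤ) ∣ x - r) : ¬ (k + 1 : ℤ) ∣ x + 1 - r := fun h' =>
    hn (by simpa using dvd_sub h' h)
  split_ifs with hadd
  · have hpred := hμ.sub_one_mem_of_addableRes_nonempty hadd (x := x)
    have hsucc := hμ.sub_one_mem_of_addableRes_nonempty hadd (x := x + 1)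
    rw [add_sub_cancel_right] at hsucc
    rw [mem_beads_addAll_iff]
    by_cases h : (k + 1 : ℤ) ∣ x - r
    · rw [affineSwap_of_dvd hn h]
      tauto
    by_cases h' : (k + 1 : ℤ) ∣ x + 1 - r
    · rw [affineSwap_of_dvd_succ hn h']
      tauto
    · rw [affineSwap_of_not_dvd h h']
      tauto
  · have hsucc := add_one_mem_of_addableRes_not_nonempty hadd (x := x)
    have hpred := add_one_mem_of_addableRes_not_nonempty hadd (x := x - 1)
    rw [sub_add_cancel] at hpred
    rw [mem_beads_removeAll_iff]
    by_cases h : (k + 1 : ℤ) ∣ x - r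
    · rw [affineSwap_of_dvd hn h]
      tauto
    by_cases h' : (k + 1 : ℤ) ∣ x + 1 - r
    · rw [affineSwap_of_dvd_succ hn h']
      tauto
    · rw [affineSwap_of_not_dvd h h']
      tauto

theorem beads_foldr_coreGen (hk : 1 ≤ k) (l : List (Fin (k + 1))) :
    beads (l.foldr (coreGen k) ⊥) = wordPerm k l '' Set.Iio 0 := by
  induction l with
  | nil => exact beads_bot.trans (Set.image_id _).symm
  | cons r l ih =>
    rw [List.foldr_cons, beads_coreGen hk r (isCore_of_beads_eq_image (wordPerm_mem k l) ih), ih,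
      Set.image_image]
    rfl

end Cores

section Bounds

variable {k : ℕ} {u : Equiv.Perm ℤ} {lam μ : YoungDiagram}

theorem shortHooks_le_card (hu : u ∈ affinePerms (k + 1)) (hμ : beads μ = u '' Set.Iio 0)
    (a : ℕ) :
    shortHooks k μ a ≤ ((Finset.range (k + 1)).filter fun i : ℕ => u i < bead μ a).card := by
  choose i hi q hq hqpos using fun b => exists_window_representative (by omega) hu (gap μ b)
  refine Finset.card_le_card_of_injOn i (fun b hb => ?_) fun b hb c hc hbc => ?_
  · simp only [Finset.coe_filter, Finset.mem_range, Set.mem_ofPred_eq] at hb ⊢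
    have hlt := gap_lt_bead hb.1
    have hq0 : q b ≤ 0 := not_lt.1 fun h => gap_notMem_beads μ b (hμ ▸ (hqpos b).2 h)
    have hnq : (k + 1 : ℤ) * q b ≤ 0 := mul_nonpos_of_nonneg_of_nonpos (by omega) hq0
    have := hi b
    have := hq b
    omega
  · simp only [Finset.coe_filter, Finset.mem_range, Set.mem_ofPred_eq] at hb hc
    have hdvd : (k + 1 : ℤ) ∣ gap μ b - gap μ c := ⟨q c - q b, by rw [hq, hq c, hbc]; ring⟩
    have hb' := hook_eq_bead_sub_gap hb.1
    have hc' := hook_eq_bead_sub_gap hc.1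
    have hb_lt := gap_lt_bead hb.1
    have hc_lt := gap_lt_bead hc.1
    have hzero : gap μ b - gap μ c = 0 :=
      Int.eq_zero_of_abs_lt_dvd hdvd (abs_lt.2 ⟨by omega, by omega⟩)
    exact (gap_strictMono μ).injective (sub_eq_zero.1 hzero)

theorem lt_bead_of_lt_shortHooks (hu : u ∈ affinePerms (k + 1)) (hμ : beads μ = u '' Set.Iio 0)
    (hmono : MonotoneOn (fun i : ℕ => u i) (Set.Iic k)) {a b : ℕ} (hab : b < shortHooks k μ a) :
    u b < bead μ a := by
  by_contra! hle
  refine (hab.trans_le (shortHooks_le_card hu hμ a)).not_ge ?_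
  rw [← Finset.card_range b]
  refine Finset.card_le_card fun i hi => ?_
  simp only [Finset.mem_filter, Finset.mem_range] at hi ⊢
  by_contra! hbi
  have : u b ≤ u i := hmono (a := b) (b := i) (hbi.trans (by omega)) (by simp; omega) hbi
  omega

/-- The number of periods of length `n` between `u 0` and `u i`, rounded down. -/
def level (n : ℤ) (u : Equiv.Perm ℤ) (i : ℕ) : ℕ := ((u i - u 0) / n).toNat

theorem level_zero (n : ℤ) (u : Equiv.Perm ℤ) : level n u 0 = 0 := by
  simp [level]

theorem level_monotoneOn (hmono : MonotoneOn (fun i : ℕ => u i) (Set.Iic k)) :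
    MonotoneOn (level (k + 1) u) (Set.Iic k) := fun i hi j hj hij =>
  Int.toNat_le_toNat <| Int.ediv_le_ediv (by omega) <|
    sub_le_sub_right (hmono hi hj hij) _

theorem exists_mem_Ioc_of_lt_bead (hu : u ∈ affinePerms (k + 1)) (hμ : beads μ = u '' Set.Iio 0)
    (hmono : MonotoneOn (fun i : ℕ => u i) (Set.Iic k)) {b : ℕ} (hb : b ≤ k) {x : ℤ}
    (hx : x ∈ beads μ) (hlt : u b < x) :
    ∃ i ∈ Finset.Ioc b k, ∃ q ∈ Finset.Icc 1 (level (k + 1) u i - level (k + 1) u b),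
      x = u i - (k + 1) * q := by
  have hn : (0 : ℤ) < k + 1 := by omega
  obtain ⟨i, hi, q, rfl, hq⟩ := exists_window_representative hn hu x
  have hqpos : 0 < q := hq.1 (hμ ▸ hx)
  have hik : i ≤ k := by omega
  lift q to ℕ using hqpos.le
  have hui : u b < u i := by
    have := mul_pos hn hqpos
    omega
  have hbi : b < i := hmono.reflect_lt hb hik hui
  have h0b : u 0 ≤ u b := hmono (a := 0) k.zero_le hb b.zero_le
  refine ⟨i, Finset.mem_Ioc.2 ⟨hbi, hik⟩, q, Finset.mem_Icc.2 ⟨by omega, ?_⟩, rfl⟩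
  have hdiv : (u b - u 0) / (k + 1) ≤ (u i - u 0) / (k + 1) - q := by
    rw [← Int.sub_mul_ediv_left _ _ hn.ne']
    exact Int.ediv_le_ediv hn (by omega)
  have h0 : 0 ≤ (u b - u 0) / (k + 1) := Int.ediv_nonneg (by omega) hn.le
  unfold level
  omega

theorem colLen_le_sum_level (hu : u ∈ affinePerms (k + 1)) (hμ : beads μ = u '' Set.Iio 0)
    (hmono : MonotoneOn (fun i : ℕ => u i) (Set.Iic k))
    (hlam : ∀ a, lam.rowLen a = shortHooks k μ a) {b : ℕ} (hb : b ≤ k) :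
    lam.colLen b ≤ ∑ i ∈ Finset.Ioc b k, (level (k + 1) u i - level (k + 1) u b) := by
  let pairs : Finset (Σ _ : ℕ, ℕ) := (Finset.Ioc b k).sigma fun i =>
    Finset.Icc 1 (level (k + 1) u i - level (k + 1) u b)
  have hsubset : (Finset.range (lam.colLen b)).image (bead μ) ⊆
      pairs.image fun p => u p.1 - (k + 1) * p.2 := by
    intro x hx
    obtain ⟨a, ha, rfl⟩ := Finset.mem_image.1 hx
    have hlt : u b < bead μ a := lt_bead_of_lt_shortHooks hu hμ hmono <| by
      rw [← hlam, ← lt_colLen_iff_lt_rowLen, ← Finset.mem_range]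
      exact ha
    obtain ⟨i, hi, q, hq, hx⟩ := exists_mem_Ioc_of_lt_bead hu hμ hmono hb ⟨a, rfl⟩ hlt
    exact Finset.mem_image.2 ⟨⟨i, q⟩, Finset.mem_sigma.2 ⟨hi, hq⟩, hx.symm⟩
  calc lam.colLen b
      = ((Finset.range (lam.colLen b)).image (bead μ)).card := by
        rw [Finset.card_image_of_injective _ (bead_strictAnti μ).injective, Finset.card_range]
    _ ≤ pairs.card := (Finset.card_le_card hsubset).trans Finset.card_image_le
    _ = _ := by simp only [pairs, Finset.card_sigma, Nat.card_Icc, Nat.add_sub_cancel]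

end Bounds

section Levels

variable {k b : ℕ} {d : ℕ → ℕ}

theorem sum_tsub_eq_sum_card_filter_lt {ι : Type*} {s : Finset ι} {f : ι → ℕ} {M : ℕ}
    (hM : ∀ j ∈ s, f j ≤ M) (c : ℕ) :
    ∑ j ∈ s, (f j - c) = ∑ t ∈ Finset.Ico c M, (s.filter fun j => t < f j).card := by
  refine (Finset.sum_congr rfl fun j hj => ?_).trans
    (Finset.sum_card_bipartiteAbove_eq_sum_card_bipartiteBelow fun j t => t < f j)
  rw [← Nat.card_Ico]
  congr 1
  ext t
  have := hM j hj
  simp only [Finset.bipartiteAbove, Finset.mem_filter, Finset.mem_Ico]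
  omega

/-- The number of columns of the rectangle that accounts for level `t`. The cut-off at `k` only
matters when no `d j` exceeds `t`, in which case any rectangle would do. -/
def levelIndex (k : ℕ) (d : ℕ → ℕ) (t : ℕ) : ℕ :=
  min k ((Finset.range (k + 1)).filter fun j => d j ≤ t).card

theorem levelIndex_le (k : ℕ) (d : ℕ → ℕ) (t : ℕ) : levelIndex k d t ≤ k := min_le_left _ _

theorem lt_levelIndex {t : ℕ} (hd : MonotoneOn d (Set.Iic k)) (hb : b < k) (ht : d b ≤ t) :
    b < levelIndex k d t := by
  refine lt_min hb (Nat.lt_of_succ_le ?_)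
  rw [Nat.succ_eq_add_one, ← Finset.card_range (b + 1)]
  refine Finset.card_le_card fun j hj => ?_
  simp only [Finset.mem_filter, Finset.mem_range] at hj ⊢
  have hjb : j ≤ b := by omega
  exact ⟨by omega, (hd (hjb.trans hb.le) hb.le hjb).trans ht⟩

theorem card_filter_lt_le_sub_levelIndex (k : ℕ) (d : ℕ → ℕ) (b t : ℕ) :
    ((Finset.Ioc b k).filter fun j => t < d j).card ≤ k + 1 - levelIndex k d t := by
  have hcompl := Finset.card_filter_add_card_filter_not (s := Finset.range (k + 1))
    fun j => d j ≤ t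
  have hsubset : (Finset.Ioc b k).filter (fun j => t < d j) ⊆
      (Finset.range (k + 1)).filter fun j => ¬ d j ≤ t := fun j hj => by
    simp only [Finset.mem_filter, Finset.mem_Ioc, Finset.mem_range, not_le] at hj ⊢
    omega
  have := Finset.card_le_card hsubset
  have := min_le_right k ((Finset.range (k + 1)).filter fun j => d j ≤ t).card
  rw [Finset.card_range] at hcompl
  unfold levelIndex
  omega

theorem sum_Ioc_tsub_le_colLen_rectUnion {M : ℕ} (hd : MonotoneOn d (Set.Iic k)) (hM : d k ≤ M)
    (hb : b < k) :
    ∑ j ∈ Finset.Ioc b k, (d j - d b) ≤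
      (rectUnion k fun t : Fin M => levelIndex k d t).colLen b := by
  let height (t : ℕ) : ℕ := if b < levelIndex k d t then k + 1 - levelIndex k d t else 0
  have hle : ∀ j ∈ Finset.Ioc b k, d j ≤ M := fun j hj =>
    (hd (Finset.mem_Ioc.1 hj).2 Set.self_mem_Iic (Finset.mem_Ioc.1 hj).2).trans hM
  calc ∑ j ∈ Finset.Ioc b k, (d j - d b)
      = ∑ t ∈ Finset.Ico (d b) M, ((Finset.Ioc b k).filter fun j => t < d j).card :=
        sum_tsub_eq_sum_card_filter_lt hle (d b)
    _ ≤ ∑ t ∈ Finset.Ico (d b) M, height t := Finset.sum_le_sum fun t ht => by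
        simp only [height, if_pos (lt_levelIndex hd hb (Finset.mem_Ico.1 ht).1)]
        exact card_filter_lt_le_sub_levelIndex k d b t
    _ ≤ ∑ t ∈ Finset.range M, height t :=
        Finset.sum_le_sum_of_subset fun t ht => Finset.mem_range.2 (Finset.mem_Ico.1 ht).2
    _ = (rectUnion k fun t : Fin M => levelIndex k d t).colLen b := by
        rw [colLen_rectUnion, Fin.sum_univ_eq_sum_range height]

end Levels

end KBounded

end

open AffineA KBounded in
theorem mainTheorem2 (k m : ℕ) (hk : 1 ≤ k) (hm : 1 ≤ m)
    (lam : YoungDiagram) (hlam : KBounded.IsKBounded k lam)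
    (w : AffineA.W k) (hw : KBounded.CorrespondsTo k lam w)
    (hdom : AffineA.alcove k w ⊆ AffineA.dominantChamber k)
    (hbelow : AffineA.alcove k w ⊆ AffineA.below k m) :
    ∃ i : Fin (m - 1) → ℕ, (∀ j, 1 ≤ i j ∧ i j ≤ k) ∧ lam ≤ KBounded.rectUnion k i := by
  obtain ⟨μ, ⟨l, hl, rfl⟩, hrow⟩ := hw
  have hu := wordPerm_mem k l
  have hmono := wordPerm_monotoneOn hk hl hdom
  have hd := level_monotoneOn hmono
  have hlevel : level (k + 1) (wordPerm k l) k ≤ m - 1 := by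
    have hdiv : (wordPerm k l k - wordPerm k l 0) / (k + 1) < m :=
      Int.ediv_lt_of_lt_mul (by omega) (mul_comm (m : ℤ) _ ▸ wordPerm_sub_lt hk hl hbelow)
    unfold level
    omega
  refine ⟨fun t => levelIndex k (level (k + 1) (wordPerm k l)) t,
    fun t => ⟨lt_levelIndex hd hk ((level_zero _ _).trans_le (Nat.zero_le _)), levelIndex_le _ _ _⟩,
    le_of_colLen_le fun b => ?_⟩
  rcases lt_or_ge b k with hb | hb
  · exact (colLen_le_sum_level hu (beads_foldr_coreGen hk l) hmono hrow hb.le).trans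
      (sum_Ioc_tsub_le_colLen_rectUnion hd hlevel hb)
  · exact (colLen_eq_zero_of_isKBounded hlam hb).trans_le (Nat.zero_le _)
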